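/- Let $X=(X_t)_{t\ge 0}$ be a nonnegative adapted process on a filtered probability space $(\Omega,\mathcal F,\{\mathcal F_t\},\mathbb P^*)$ with $X_0=x_0$ a.s. for some $x_0>0$, $\mathbb E^*[X_t]<\infty$ for all $t>0$, and such that $(e^{-rt}X_t)_{t\ge 0}$ is a martingale, where $r\ge 0$. Let $C(T,K)=e^{-rT}\,\mathbb E^*[(X_T-K)^+]$ be the call pricing function, and assume $C\in PF_\infty$, i.e. $C(T,K)>0$ for all $T>0$ and $K>0$ with $x_0e^{rT}\le K$. Let $$C_{BS}(T,K,\sigma)=x_0N(d_1)-Ke^{-rT}N(d_2),\quad d_1=\frac{\log x_0-\log K+(r+\frac12\sigma^2)T}{\sigma\sqrt T},\quad d_2=d_1-\sigma\sqrt T,$$ with $N$ the standard normal distribution function. Fix $T>0$, write $C(K)=C(T,K)$, and assume $\tilde p:=\sup\{p\ge 0:\mathbb E^*[X_T^{1+p}]<\infty\}=0$. Then for every $K\ge x_0e^{rT}$ there is exactly one $\sigma=I(K)>0$ (the implied volatility) with $C(K)=C_{BS}(T,K,\sigma)$, and the condition $$I(K)\sim\left(\frac2T\right)^{1/2}\sqrt{\log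 K},\qquad K\to\infty,$$ holds if and only if there exist a positive slowly varying function $g_1$ and a number $K_0$ with $g_1(K)\le C(K)$ for all $K>K_0$. The same condition also holds if and only if $C$ is of weak Pareto type near infinity with index $0$, i.e. there exist positive slowly varying functions $f_1,f_2$ and $y_0$ with $f_1(K)\le C(K)\le f_2(K)$ for all $K>y_0$ (and $C$ is positive and measurable on some $(c,\infty)$, $c\ge 0$). Here a function $f$, Lebesgue measurable on a neighborhood of infinity, is slowly varying if $f(\lambda x)/f(x)\to 1$ as $x\to\infty$ for every $\lambda>0$. -/

import Mathlib

open Filter Topology MeasureTheory Asymptotics Set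
open scoped NNReal ENNReal

noncomputable section

/-- The standing assumptions on the stock price process `X` with initial price `x₀` and interest
rate `r`: a nonnegative adapted integrable process with `X 0 = x₀` almost surely whose discounted
version `exp (-r t) * X t` is a martingale. -/
structure IsStockPrice {Ω : Type*} {m : MeasurableSpace Ω} (P : Measure Ω)
    (ℱ : Filtration ℝ≥0 m) (r x₀ : ℝ) (X : ℝ≥0 → Ω → ℝ) : Prop where
  rate_nonneg : 0 ≤ r
  initial_pos : 0 < x₀
  nonneg : ∀ t ω, 0 ≤ X t ω
  adapted : StronglyAdapted ℱ X
  initial : ∀ᵐ ω ∂P, X 0 ω = x₀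
  integrable : ∀ t, 0 < t → Integrable (X t) P
  martingale : Martingale (fun (t : ℝ≥0) ω => Real.exp (-r * t) * X t ω) ℱ P

/-- The European call pricing function `C(T, K) = exp (-r T) E[(X_T - K)⁺]`. -/
def callPrice {Ω : Type*} {m : MeasurableSpace Ω} (P : Measure Ω) (r : ℝ) (X : ℝ≥0 → Ω → ℝ)
    (T : ℝ≥0) (K : ℝ) : ℝ :=
  Real.exp (-r * T) * ∫ ω, max (X T ω - K) 0 ∂P

/-- The class `PF_∞` of pricing functions: `C(T, K) > 0` for all `T > 0` and `K > 0` with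
`x₀ exp (r T) ≤ K`. -/
def IsPFInfty (r x₀ : ℝ) (C : ℝ≥0 → ℝ → ℝ) : Prop :=
  ∀ (T : ℝ≥0) (K : ℝ), 0 < T → 0 < K → x₀ * Real.exp (r * T) ≤ K → 0 < C T K

/-- The standard normal distribution function. -/
def stdNormalCDF (z : ℝ) : ℝ :=
  1 / Real.sqrt (2 * Real.pi) * ∫ y in Iic z, Real.exp (-(y ^ 2 / 2))

/-- The quantity `d₁(K, σ)` of the Black-Scholes formula. -/
def bsD1 (r x₀ : ℝ) (T : ℝ≥0) (K σ : ℝ) : ℝ :=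
  (Real.log x₀ - Real.log K + (r + 1 / 2 * σ ^ 2) * T) / (σ * Real.sqrt T)

/-- The quantity `d₂(K, σ)` of the Black-Scholes formula. -/
def bsD2 (r x₀ : ℝ) (T : ℝ≥0) (K σ : ℝ) : ℝ :=
  bsD1 r x₀ T K σ - σ * Real.sqrt T

/-- The Black-Scholes call price `C_BS(T, K, σ)`. -/
def bsCallPrice (r x₀ : ℝ) (T : ℝ≥0) (K σ : ℝ) : ℝ :=
  x₀ * stdNormalCDF (bsD1 r x₀ T K σ)
    - K * Real.exp (-r * T) * stdNormalCDF (bsD2 r x₀ T K σ)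

/-- `σ` is a volatility parameter (a positive number) for which the Black-Scholes price equals
`C(T, K)`. -/
def IsImpliedVol (r x₀ : ℝ) (C : ℝ≥0 → ℝ → ℝ) (T : ℝ≥0) (K σ : ℝ) : Prop :=
  0 < σ ∧ C T K = bsCallPrice r x₀ T K σ

open Classical in
/-- The implied volatility `I(T, K)`: the unique `σ > 0` with `C(T, K) = C_BS(T, K, σ)`.
It is set to `0` where such a number does not exist or is not unique. -/
def impliedVol (r x₀ : ℝ) (C : ℝ≥0 → ℝ → ℝ) (T : ℝ≥0) (K : ℝ) : ℝ :=
  if h : ∃! σ, IsImpliedVol r x₀ C T K σ then h.choose else 0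

/-- The critical exponent `sup {p ≥ 0 : E[Y ^ (1 + p)] < ∞} ∈ [0, ∞]` of a nonnegative random
variable `Y`. -/
def momentExponent {Ω : Type*} {m : MeasurableSpace Ω} (P : Measure Ω) (Y : Ω → ℝ) : ℝ≥0∞ :=
  ⨆ (p : ℝ≥0) (_ : ∫⁻ ω, ENNReal.ofReal (Y ω ^ (1 + (p : ℝ))) ∂P < ∞), (p : ℝ≥0∞)

/-- The class `R_α`: `f` is Lebesgue measurable on a neighborhood of infinity, and
`f (lam * x) / f x → lam ^ α` as `x → ∞` for every `lam > 0`. Lebesgue measurability of a real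
function is a.e. measurability with respect to Lebesgue measure. -/
def IsRegularlyVarying (α : ℝ) (f : ℝ → ℝ) : Prop :=
  (∃ a : ℝ, AEMeasurable f (volume.restrict (Ioi a))) ∧
    ∀ lam : ℝ, 0 < lam → Tendsto (fun x => f (lam * x) / f x) atTop (𝓝 (lam ^ α))

/-- Slowly varying functions, the class `R_0`. -/
def IsSlowlyVarying (f : ℝ → ℝ) : Prop := IsRegularlyVarying 0 f

/-- Functions of weak Pareto type near infinity with index `α`: `F` is positive and Lebesgue
measurable on some `(c, ∞)` with `c ≥ 0`, and `f₁ ≤ F ≤ f₂` near infinity for some positive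
`f₁, f₂ ∈ R_α`. -/
def IsWeakParetoType (α : ℝ) (F : ℝ → ℝ) : Prop :=
  (∃ c : ℝ, 0 ≤ c ∧ AEMeasurable F (volume.restrict (Ioi c)) ∧ ∀ y, c < y → 0 < F y) ∧
    ∃ f₁ f₂ : ℝ → ℝ, IsRegularlyVarying α f₁ ∧ IsRegularlyVarying α f₂ ∧
      ∃ y₀ : ℝ, ∀ y, y₀ < y → 0 < f₁ y ∧ 0 < f₂ y ∧ f₁ y ≤ F y ∧ F y ≤ f₂ y

end

/-!
Write `k = log K - log x₀ - r T` and `v = σ √T`. Then the Black-Scholes price is `x₀ * F k v`,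
where `F k v = N(-k/v + v/2) - exp k * N(-k/v - v/2)` (`bsNormalized`). By the vega formula
`∂F/∂v = n(d₁) > 0`, so `F k` is strictly increasing; it is at most `v` for `k ≥ 0` and tends to `1`
as `v → ∞`. Since `0 < C(K) < x₀`, the implied volatility exists and is unique
(`existsUnique_isImpliedVol`).

The condition on `I` says that `v ^ 2 / (2 k) → 1`. Along `v = √(2 a k)` with `a < 1` the price `F`
is `exp (-(1 - a) ^ 2 / (4 a) * k)` up to factors that are not exponential, with a rate that
vanishes as `a → 1`; for `a > 1` it stays away from `0`. As `C(K) → 0`, it follows that the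
condition on `I` holds if and only if `C(K) ≥ K ^ (-ε)` eventually, for every `ε > 0`
(`tendsto_sq_div_iff_decaysSubexponentially`).

Finally, an antitone `C` has this property if and only if it has a positive slowly varying minorant.
Given a minorant, one iterates `g (2 x) / g x → 1` along powers of `2` and uses that `C` is antitone
in between, so that no uniform convergence theorem is needed. Conversely, if `e t` is the least
rate `δ` with `exp (-δ y) ≤ C(exp y)` for all `y ≥ t`, then `e` is antitone with limit `0`, and
`exp (-∫ t in 0..log K, e t)` is a slowly varying minorant. The slowly varying majorant that the
weak Pareto type requires is the constant `x₀`.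
-/

/-! ### The standard normal distribution function -/

/-- The standard normal density. -/
noncomputable def stdNormalPDF (z : ℝ) : ℝ :=
  1 / Real.sqrt (2 * Real.pi) * Real.exp (-(z ^ 2 / 2))

theorem stdNormalPDF_pos (z : ℝ) : 0 < stdNormalPDF z := by
  unfold stdNormalPDF; positivity

theorem one_le_sqrt_two_pi : 1 ≤ Real.sqrt (2 * Real.pi) := by
  rw [Real.one_le_sqrt]; linarith [Real.pi_gt_three]

theorem stdNormalPDF_le_one (z : ℝ) : stdNormalPDF z ≤ 1 := by
  have h : 1 / Real.sqrt (2 * Real.pi) ≤ 1 := by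
    rw [div_le_one (by positivity)]; exact one_le_sqrt_two_pi
  have h2 : Real.exp (-(z ^ 2 / 2)) ≤ 1 := Real.exp_le_one_iff.2 (by nlinarith [sq_nonneg z])
  exact mul_le_one₀ h (Real.exp_pos _).le h2

theorem integrable_exp_neg_sq_div_two : Integrable fun y : ℝ => Real.exp (-(y ^ 2 / 2)) := by
  refine (integrable_exp_neg_mul_sq (b := 1 / 2) (by norm_num)).congr (ae_of_all _ fun y => ?_)
  simp only []
  congr 1; ring

theorem integral_exp_neg_sq_div_two :
    ∫ y : ℝ, Real.exp (-(y ^ 2 / 2)) = Real.sqrt (2 * Real.pi) := by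
  rw [show Real.sqrt (2 * Real.pi) = Real.sqrt (Real.pi / (1 / 2)) by congr 1; ring,
    ← integral_gaussian]
  congr 1; ext y; congr 1; ring

theorem hasDerivAt_stdNormalCDF (z : ℝ) : HasDerivAt stdNormalCDF (stdNormalPDF z) z := by
  have hc : Continuous fun y : ℝ => Real.exp (-(y ^ 2 / 2)) := by fun_prop
  have key : ∀ w : ℝ, stdNormalCDF w = 1 / Real.sqrt (2 * Real.pi) *
      ((∫ y in Iic (0 : ℝ), Real.exp (-(y ^ 2 / 2))) + ∫ y in (0 : ℝ)..w, Real.exp (-(y ^ 2 / 2))) := by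
    intro w
    rw [stdNormalCDF, ← intervalIntegral.integral_Iic_sub_Iic
      integrable_exp_neg_sq_div_two.integrableOn integrable_exp_neg_sq_div_two.integrableOn]
    ring
  have h := (intervalIntegral.integral_hasDerivAt_right
    (hc.intervalIntegrable 0 z) hc.stronglyMeasurable.stronglyMeasurableAtFilter
    hc.continuousAt)
  rw [show stdNormalCDF = _ from funext key]
  exact (h.const_add _).const_mul _

theorem stdNormalCDF_strictMono : StrictMono stdNormalCDF :=
  strictMono_of_hasDerivAt_pos hasDerivAt_stdNormalCDF stdNormalPDF_pos

theorem stdNormalCDF_nonneg (z : ℝ) : 0 ≤ stdNormalCDF z := by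
  unfold stdNormalCDF
  exact mul_nonneg (by positivity) (integral_nonneg fun y => (Real.exp_pos _).le)

theorem tendsto_stdNormalCDF_atTop : Tendsto stdNormalCDF atTop (𝓝 1) := by
  have h := (aecover_Iic (μ := (volume : Measure ℝ)) tendsto_id).integral_tendsto_of_countably_generated
    integrable_exp_neg_sq_div_two
  have h2 := h.const_mul (1 / Real.sqrt (2 * Real.pi))
  rw [integral_exp_neg_sq_div_two, one_div_mul_cancel (by positivity)] at h2
  exact h2

theorem stdNormalCDF_zero : stdNormalCDF 0 = 1 / 2 := by
  have h1 : ∫ y in Iic (0 : ℝ), Real.exp (-(y ^ 2 / 2)) =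
      ∫ y in Ioi (0 : ℝ), Real.exp (-(y ^ 2 / 2)) := by
    have := integral_comp_neg_Iic (0 : ℝ) (fun y : ℝ => Real.exp (-(y ^ 2 / 2)))
    simpa using this
  have h2 := intervalIntegral.integral_Iic_add_Ioi (b := (0 : ℝ)) (μ := volume)
    integrable_exp_neg_sq_div_two.integrableOn integrable_exp_neg_sq_div_two.integrableOn
  rw [← h1, integral_exp_neg_sq_div_two] at h2
  have : ∫ y in Iic (0 : ℝ), Real.exp (-(y ^ 2 / 2)) = Real.sqrt (2 * Real.pi) / 2 := by linarith
  rw [stdNormalCDF, this]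
  field_simp

/-- The Gaussian tail bound; it follows from `(z + u) ^ 2 ≥ z ^ 2 + u ^ 2` for `z, u ≤ 0`. -/
theorem stdNormalCDF_le_exp {z : ℝ} (hz : z ≤ 0) :
    stdNormalCDF z ≤ 1 / 2 * Real.exp (-(z ^ 2 / 2)) := by
  have h1 : ∫ y in Iic z, Real.exp (-(y ^ 2 / 2)) =
      ∫ u in Iic (0 : ℝ), Real.exp (-((z + u) ^ 2 / 2)) := by
    have := (measurePreserving_add_left (volume : Measure ℝ) z).setIntegral_preimage_emb
      (measurableEmbedding_addLeft z) (fun y => Real.exp (-(y ^ 2 / 2))) (Iic z)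
    rw [← this]
    congr 2
    ext u; simp
  have h2 : ∫ u in Iic (0 : ℝ), Real.exp (-((z + u) ^ 2 / 2)) ≤
      ∫ u in Iic (0 : ℝ), Real.exp (-(z ^ 2 / 2)) * Real.exp (-(u ^ 2 / 2)) := by
    refine setIntegral_mono_on ?_ ?_ measurableSet_Iic ?_
    · exact (integrable_exp_neg_sq_div_two.comp_add_left z).integrableOn
    · exact (integrable_exp_neg_sq_div_two.const_mul _).integrableOn
    · intro u hu
      rw [← Real.exp_add]
      refine Real.exp_le_exp.2 ?_
      nlinarith [mul_nonneg_of_nonpos_of_nonpos hz (mem_Iic.1 hu)]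
  rw [integral_const_mul] at h2
  have h3 := stdNormalCDF_zero
  unfold stdNormalCDF at h3 ⊢
  rw [h1]
  calc _ ≤ 1 / Real.sqrt (2 * Real.pi) * (Real.exp (-(z ^ 2 / 2)) *
        ∫ u in Iic (0 : ℝ), Real.exp (-(u ^ 2 / 2))) := by gcongr
    _ = _ := by rw [← h3]; ring

theorem tendsto_stdNormalCDF_atBot : Tendsto stdNormalCDF atBot (𝓝 0) := by
  have h : Tendsto (fun z : ℝ => 1 / 2 * Real.exp z) atBot (𝓝 0) := by
    simpa using Real.tendsto_exp_atBot.const_mul (1 / 2 : ℝ)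
  refine tendsto_of_tendsto_of_tendsto_of_le_of_le' tendsto_const_nhds h
    (Eventually.of_forall stdNormalCDF_nonneg) ?_
  filter_upwards [eventually_le_atBot (-2 : ℝ)] with z hz
  refine (stdNormalCDF_le_exp (by linarith)).trans ?_
  have : -(z ^ 2 / 2) ≤ z := by nlinarith
  gcongr

theorem stdNormalCDF_sub_le {a b : ℝ} (h : a ≤ b) : stdNormalCDF b - stdNormalCDF a ≤ b - a := by
  have := Convex.image_sub_le_mul_sub_of_deriv_le (convex_univ) (f := stdNormalCDF) (C := 1)
    (fun z _ => (hasDerivAt_stdNormalCDF z).continuousAt.continuousWithinAt)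
    (fun z _ => (hasDerivAt_stdNormalCDF z).differentiableAt.differentiableWithinAt)
    (fun z _ => by rw [(hasDerivAt_stdNormalCDF z).deriv]; exact stdNormalPDF_le_one z)
    a (mem_univ _) b (mem_univ _) h
  linarith

/-! ### The normalized Black-Scholes price -/

/-- The Black-Scholes price divided by the initial price, as a function of the log-moneyness
`k = log K - log x₀ - r T` and the total volatility `v = σ √T`. -/
noncomputable def bsNormalized (k v : ℝ) : ℝ :=
  stdNormalCDF (-k / v + v / 2) - Real.exp k * stdNormalCDF (-k / v - v / 2)

/-- The vega formula. The terms containing the derivative of `k / v` cancel, because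
`exp k * n(d₂) = n(d₁)`. -/
theorem hasDerivAt_bsNormalized (k : ℝ) {v : ℝ} (hv : 0 < v) :
    HasDerivAt (bsNormalized k) (stdNormalPDF (-k / v + v / 2)) v := by
  have hq : HasDerivAt (fun v : ℝ => -k / v) (k / v ^ 2) v := by
    have := (hasDerivAt_inv hv.ne').const_mul (-k)
    refine (this.congr_deriv ?_).congr_of_eventuallyEq (Eventually.of_forall fun w => ?_)
    · field_simp
    · simp [div_eq_mul_inv]
  have hh : HasDerivAt (fun v : ℝ => v / 2) (1 / 2) v := (hasDerivAt_id v).div_const 2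
  have h1 := (hasDerivAt_stdNormalCDF (-k / v + v / 2)).comp v (hq.add hh)
  have h2 := (hasDerivAt_stdNormalCDF (-k / v - v / 2)).comp v (hq.sub hh)
  refine (h1.sub (h2.const_mul (Real.exp k))).congr_deriv ?_
  have h3 : Real.exp k * stdNormalPDF (-k / v - v / 2) = stdNormalPDF (-k / v + v / 2) := by
    unfold stdNormalPDF
    rw [mul_left_comm, ← Real.exp_add]
    congr 2
    field_simp
    ring
  linear_combination (-(k / v ^ 2 - 1 / 2)) * h3

theorem bsNormalized_strictMonoOn (k : ℝ) : StrictMonoOn (bsNormalized k) (Ioi 0) := by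
  refine strictMonoOn_of_deriv_pos (convex_Ioi 0)
    (fun v hv => (hasDerivAt_bsNormalized k hv).continuousAt.continuousWithinAt) fun v hv => ?_
  rw [interior_Ioi] at hv
  rw [(hasDerivAt_bsNormalized k hv).deriv]
  exact stdNormalPDF_pos _

theorem bsNormalized_le_stdNormalCDF (k v : ℝ) :
    bsNormalized k v ≤ stdNormalCDF (-k / v + v / 2) := by
  have := mul_nonneg (Real.exp_pos k).le (stdNormalCDF_nonneg (-k / v - v / 2))
  unfold bsNormalized; linarith

theorem bsNormalized_le_self {k v : ℝ} (hk : 0 ≤ k) (hv : 0 ≤ v) : bsNormalized k v ≤ v := by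
  have h1 := stdNormalCDF_sub_le (a := -k / v - v / 2) (b := -k / v + v / 2) (by linarith)
  have h2 := mul_le_mul_of_nonneg_right (Real.one_le_exp hk)
    (stdNormalCDF_nonneg (-k / v - v / 2))
  unfold bsNormalized; linarith

theorem tendsto_bsNormalized_atTop (k : ℝ) : Tendsto (bsNormalized k) atTop (𝓝 1) := by
  have hq : Tendsto (fun v : ℝ => -k / v) atTop (𝓝 0) := tendsto_const_nhds.div_atTop tendsto_id
  have hh : Tendsto (fun v : ℝ => v / 2) atTop atTop := tendsto_id.atTop_div_const (by norm_num)
  have h1 := tendsto_stdNormalCDF_atTop.comp (hq.add_atTop hh)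
  have h2 := tendsto_stdNormalCDF_atBot.comp
    (hq.add_atBot (tendsto_neg_atTop_atBot.comp hh))
  have h3 := h1.sub (h2.const_mul (Real.exp k))
  rw [mul_zero, sub_zero] at h3
  refine h3.congr fun v => ?_
  simp only [bsNormalized, Function.comp, sub_eq_add_neg]

theorem existsUnique_bsNormalized_eq {k c : ℝ} (hk : 0 ≤ k) (hc0 : 0 < c) (hc1 : c < 1) :
    ∃! v, 0 < v ∧ c = bsNormalized k v := by
  obtain ⟨w, hw, hw0⟩ := (((tendsto_bsNormalized_atTop k).eventually_const_lt hc1).and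
    (eventually_gt_atTop (c / 2))).exists
  have hcont : ContinuousOn (bsNormalized k) (Icc (c / 2) w) := fun v hv =>
    (hasDerivAt_bsNormalized k (by linarith [hv.1] : 0 < v)).continuousAt.continuousWithinAt
  obtain ⟨v, hv, hvc⟩ := intermediate_value_Icc hw0.le hcont
    ⟨(bsNormalized_le_self hk (by linarith)).trans (by linarith), hw.le⟩
  have hv0 : 0 < v := by linarith [hv.1]
  refine ⟨v, ⟨hv0, hvc.symm⟩, fun u hu => ?_⟩
  exact (bsNormalized_strictMonoOn k).injOn hu.1 hv0 (hu.2.symm.trans hvc.symm)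

theorem bsNormalized_nonneg {k v : ℝ} (hk : 0 < k) (hv : 0 < v) : 0 ≤ bsNormalized k v := by
  have hq : Tendsto (fun w : ℝ => -k / w - w / 2) (𝓝[>] 0) atBot := by
    have h1 : Tendsto (fun w : ℝ => -k * w⁻¹) (𝓝[>] 0) atBot :=
      tendsto_inv_nhdsGT_zero.const_mul_atTop_of_neg (by linarith)
    have h2 : Tendsto (fun w : ℝ => -(w / 2)) (𝓝[>] 0) (𝓝 (-(0 / 2))) :=
      (Continuous.tendsto (by fun_prop) 0).mono_left nhdsWithin_le_nhds
    refine (h1.atBot_add h2).congr fun w => ?_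
    rw [sub_eq_add_neg, div_eq_mul_inv (-k)]
  have h := ((tendsto_stdNormalCDF_atBot.comp hq).const_mul (Real.exp k)).neg
  rw [mul_zero, neg_zero] at h
  refine le_of_tendsto h ?_
  filter_upwards [Ioo_mem_nhdsGT hv] with w hw
  have h1 := (bsNormalized_strictMonoOn k).monotoneOn hw.1 hv hw.2.le
  have h2 := stdNormalCDF_nonneg (-k / w + w / 2)
  simp only [Function.comp]
  unfold bsNormalized at h1 ⊢
  linarith

/-! ### Normalized prices along `v = √(2 a k)` -/

/-- Half the square of `d₁` (for `s = 1`) and of `d₂` (for `s = -1`) at `v = √(2 a k)`. -/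
theorem sq_sqrt_ratio {a k : ℝ} (ha : 0 < a) (hk : 0 < k) (s : ℝ) :
    (-k / Real.sqrt (2 * a * k) + s * Real.sqrt (2 * a * k) / 2) ^ 2 / 2 =
      (1 - s * a) ^ 2 / (4 * a) * k := by
  have h0 : 0 < 2 * a * k := by positivity
  have h := Real.sq_sqrt h0.le
  have hs := Real.sqrt_pos.2 h0
  generalize Real.sqrt (2 * a * k) = w at h hs
  have : (-k / w + s * w / 2) ^ 2 = (-k + s * w ^ 2 / 2) ^ 2 / w ^ 2 := by
    field_simp
  rw [this, h]
  field_simp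
  ring

theorem d1_sqrt_nonpos {a k : ℝ} (ha : 0 < a) (ha1 : a ≤ 1) (hk : 0 < k) :
    -k / Real.sqrt (2 * a * k) + Real.sqrt (2 * a * k) / 2 ≤ 0 := by
  have h0 : 0 < 2 * a * k := by positivity
  have h := Real.sq_sqrt h0.le
  have hs := Real.sqrt_pos.2 h0
  have : -k / Real.sqrt (2 * a * k) + Real.sqrt (2 * a * k) / 2 =
      (-k + Real.sqrt (2 * a * k) ^ 2 / 2) / Real.sqrt (2 * a * k) := by field_simp
  rw [this, h]
  exact div_nonpos_of_nonpos_of_nonneg (by nlinarith) hs.le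

theorem bsNormalized_sqrt_le {a k : ℝ} (ha : 0 < a) (ha1 : a ≤ 1) (hk : 0 < k) :
    bsNormalized k (Real.sqrt (2 * a * k)) ≤ Real.exp (-((1 - a) ^ 2 / (4 * a) * k)) := by
  refine (bsNormalized_le_stdNormalCDF _ _).trans
    ((stdNormalCDF_le_exp (d1_sqrt_nonpos ha ha1 hk)).trans ?_)
  have := sq_sqrt_ratio ha hk 1
  rw [one_mul, one_mul] at this
  rw [this]
  linarith [Real.exp_pos (-((1 - a) ^ 2 / (4 * a) * k))]

theorem le_bsNormalized_sqrt {a k : ℝ} (ha : 1 ≤ a) (hk : 0 < k) :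
    1 / 2 - 1 / 2 * Real.exp (-((a - 1) ^ 2 / (4 * a) * k)) ≤
      bsNormalized k (Real.sqrt (2 * a * k)) := by
  have ha0 : 0 < a := by linarith
  have h0 : 0 < 2 * a * k := by positivity
  have hs := Real.sqrt_pos.2 h0
  have hd1 : 0 ≤ -k / Real.sqrt (2 * a * k) + Real.sqrt (2 * a * k) / 2 := by
    have h := Real.sq_sqrt h0.le
    have : -k / Real.sqrt (2 * a * k) + Real.sqrt (2 * a * k) / 2 =
      (-k + Real.sqrt (2 * a * k) ^ 2 / 2) / Real.sqrt (2 * a * k) := by field_simp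
    rw [this, h]
    exact div_nonneg (by nlinarith) hs.le
  have hd2 : -k / Real.sqrt (2 * a * k) - Real.sqrt (2 * a * k) / 2 ≤ 0 := by
    have : 0 ≤ k / Real.sqrt (2 * a * k) := by positivity
    rw [neg_div]; linarith
  have h1 := stdNormalCDF_strictMono.monotone hd1
  have h2 := mul_le_mul_of_nonneg_left (stdNormalCDF_le_exp hd2) (Real.exp_pos k).le
  have hsq := sq_sqrt_ratio ha0 hk (-1)
  rw [show -k / Real.sqrt (2 * a * k) + -1 * Real.sqrt (2 * a * k) / 2 =
    -k / Real.sqrt (2 * a * k) - Real.sqrt (2 * a * k) / 2 by ring] at hsq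
  rw [hsq, mul_left_comm, ← Real.exp_add, show k + -((1 - -1 * a) ^ 2 / (4 * a) * k) =
    -((a - 1) ^ 2 / (4 * a) * k) by field_simp; ring] at h2
  rw [stdNormalCDF_zero] at h1
  unfold bsNormalized
  linarith

/-- A lower bound obtained by integrating vega between `√(2 b k)` and `√(2 a k)`. -/
theorem mul_exp_le_bsNormalized_sqrt {a b k : ℝ} (hb : 0 < b) (hba : b < a) (ha : a ≤ 1)
    (hk : 0 < k) :
    (Real.sqrt (2 * a * k) - Real.sqrt (2 * b * k)) / Real.sqrt (2 * Real.pi) *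
      Real.exp (-((1 - b) ^ 2 / (4 * b) * k)) ≤ bsNormalized k (Real.sqrt (2 * a * k)) := by
  have hw : 0 < Real.sqrt (2 * b * k) := Real.sqrt_pos.2 (by positivity)
  have hwv : Real.sqrt (2 * b * k) < Real.sqrt (2 * a * k) :=
    Real.sqrt_lt_sqrt (by positivity) (by gcongr)
  have hd1 := d1_sqrt_nonpos (hb.trans hba) ha hk
  have hsq := sq_sqrt_ratio hb hk 1
  rw [one_mul, one_mul] at hsq
  generalize Real.sqrt (2 * b * k) = w at hw hwv hsq
  generalize Real.sqrt (2 * a * k) = v at hwv hd1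
  obtain ⟨ξ, hξ, hξe⟩ := exists_hasDerivAt_eq_slope (bsNormalized k) _ hwv
    (fun u hu => (hasDerivAt_bsNormalized k
      (hw.trans_le hu.1)).continuousAt.continuousWithinAt)
    (fun u hu => hasDerivAt_bsNormalized k (hw.trans hu.1))
  have hξ0 : 0 < ξ := hw.trans hξ.1
  -- `d₁` is increasing in the volatility and nonpositive at `v`, so `d₁ ^ 2` is largest at `w`.
  have e1 : -k / w + w / 2 ≤ -k / ξ + ξ / 2 := by
    have : k / ξ ≤ k / w := by gcongr; exact hξ.1.le
    rw [neg_div, neg_div]; linarith [hξ.1]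
  have e2 : -k / ξ + ξ / 2 ≤ -k / v + v / 2 := by
    have : k / v ≤ k / ξ := by gcongr; exact hξ.2.le
    rw [neg_div, neg_div]; linarith [hξ.2]
  have e3 : 1 / Real.sqrt (2 * Real.pi) * Real.exp (-((1 - b) ^ 2 / (4 * b) * k)) ≤
      stdNormalPDF (-k / ξ + ξ / 2) := by
    rw [← hsq]
    unfold stdNormalPDF
    gcongr ?_ * Real.exp (-(?_ / 2))
    nlinarith
  have e4 := bsNormalized_nonneg hk hw
  rw [eq_div_iff (by linarith)] at hξe
  have e5 := mul_le_mul_of_nonneg_right e3 (by linarith : 0 ≤ v - w)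
  calc _ = 1 / Real.sqrt (2 * Real.pi) * Real.exp (-((1 - b) ^ 2 / (4 * b) * k)) * (v - w) := by
        ring
    _ ≤ _ := by linarith

/-! ### Total volatility and subexponential decay of the price -/

/-- `c` is eventually larger than `exp (-ε k)` for every `ε > 0`. With `k = log K` this says that
`c` eventually dominates every negative power of `K`. -/
def DecaysSubexponentially {α : Type*} (l : Filter α) (k c : α → ℝ) : Prop :=
  ∀ ε > 0, ∀ᶠ x in l, Real.exp (-(ε * k x)) ≤ c x

theorem DecaysSubexponentially.const_mul_shift {α : Type*} {l : Filter α} {k c : α → ℝ}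
    (hk : Tendsto k l atTop) (h : DecaysSubexponentially l k c) {x : ℝ} (hx : 0 < x) (κ : ℝ) :
    DecaysSubexponentially l (fun y => k y + κ) (fun y => x * c y) := by
  intro ε hε
  filter_upwards [h (ε / 2) (by linarith),
    hk.eventually_ge_atTop ((-(ε * κ) - Real.log x) / (ε / 2))] with y hy hky
  rw [div_le_iff₀ (by linarith)] at hky
  calc Real.exp (-(ε * (k y + κ))) ≤ Real.exp (Real.log x + -(ε / 2 * k y)) :=
        Real.exp_le_exp.2 (by nlinarith)
    _ = x * Real.exp (-(ε / 2 * k y)) := by rw [Real.exp_add, Real.exp_log hx]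
    _ ≤ _ := by gcongr

/-- The total volatility `v` is asymptotic to `√(2 k)` exactly if the normalized price decays
subexponentially in `k`: along `v = √(2 a k)` with `a < 1` the price decays exponentially, with a
rate that tends to `0` as `a → 1`, while for `a > 1` it does not tend to `0`. -/
theorem tendsto_sq_div_iff_decaysSubexponentially {α : Type*} {l : Filter α} {k v : α → ℝ}
    (hk : Tendsto k l atTop) (hv : ∀ᶠ x in l, 0 < v x)
    (h0 : Tendsto (fun x => bsNormalized (k x) (v x)) l (𝓝 0)) :
    Tendsto (fun x => v x ^ 2 / (2 * k x)) l (𝓝 1) ↔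
      DecaysSubexponentially l k (fun x => bsNormalized (k x) (v x)) := by
  constructor
  · intro h ε hε
    obtain ⟨b, hb, hb1, hbε⟩ : ∃ b : ℝ, 0 < b ∧ b < 1 ∧ (1 - b) ^ 2 / (4 * b) ≤ ε := by
      have h1 : min (1 / 2) ε ≤ 1 / 2 := min_le_left _ _
      have h2 : min (1 / 2) ε ≤ ε := min_le_right _ _
      have h3 : 0 < min (1 / 2) ε := lt_min (by norm_num) hε
      refine ⟨1 - min (1 / 2) ε, by linarith, by linarith, ?_⟩
      rw [div_le_iff₀ (by linarith)]
      nlinarith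
    obtain ⟨a, hba, ha⟩ := exists_between hb1
    have hgrow : Tendsto (fun x => (Real.sqrt (2 * a) - Real.sqrt (2 * b)) * Real.sqrt (k x))
        l atTop :=
      (Real.tendsto_sqrt_atTop.comp hk).const_mul_atTop
        (sub_pos.2 (Real.sqrt_lt_sqrt (by linarith) (by linarith)))
    filter_upwards [hk.eventually_gt_atTop 0, hv, h.eventually_const_lt ha,
      hgrow.eventually_ge_atTop (Real.sqrt (2 * Real.pi))] with x hkx hvx hax hgx
    have hle := mul_exp_le_bsNormalized_sqrt hb hba ha.le hkx
    rw [lt_div_iff₀ (by linarith)] at hax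
    have hmono := (bsNormalized_strictMonoOn (k x)).monotoneOn
      (show Real.sqrt (2 * a * k x) ∈ Ioi 0 from
        Real.sqrt_pos.2 (mul_pos (mul_pos two_pos (hb.trans hba)) hkx)) hvx
      ((Real.sqrt_le_left hvx.le).2 (by linarith))
    refine le_trans ?_ (hle.trans hmono)
    rw [Real.sqrt_mul (x := 2 * a) (by linarith), Real.sqrt_mul (x := 2 * b) (by linarith),
      ← sub_mul]
    refine (Real.exp_le_exp.2 (neg_le_neg (mul_le_mul_of_nonneg_right hbε hkx.le))).trans ?_
    exact le_mul_of_one_le_left (Real.exp_pos _).le ((one_le_div (by positivity)).2 hgx)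
  · intro h
    refine tendsto_order.2 ⟨fun b hb1 => ?_, fun a ha1 => ?_⟩
    · rcases le_or_gt b 0 with hb | hb
      · filter_upwards [hk.eventually_gt_atTop 0, hv] with x hkx hvx
        exact hb.trans_lt (by positivity)
      have hδ : 0 < (1 - b) ^ 2 / (4 * b) := by have := sub_pos.2 hb1; positivity
      filter_upwards [hk.eventually_gt_atTop 0, hv, h _ (half_pos hδ)] with x hkx hvx hx
      by_contra hcon
      rw [not_lt, div_le_iff₀ (by linarith)] at hcon
      have hmono := (bsNormalized_strictMonoOn (k x)).monotoneOn hvx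
        (show Real.sqrt (2 * b * k x) ∈ Ioi 0 from Real.sqrt_pos.2 (by positivity))
        (Real.le_sqrt_of_sq_le (by linarith))
      have := Real.exp_le_exp.1 (hx.trans (hmono.trans (bsNormalized_sqrt_le hb hb1.le hkx)))
      nlinarith [mul_pos hδ hkx]
    · have ha0 : 0 < a := by linarith
      have hδ : 0 < (a - 1) ^ 2 / (4 * a) := by have := sub_pos.2 ha1; positivity
      have hexp : Tendsto (fun x => Real.exp (-((a - 1) ^ 2 / (4 * a) * k x))) l (𝓝 0) :=
        Real.tendsto_exp_neg_atTop_nhds_zero.comp (hk.const_mul_atTop hδ)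
      filter_upwards [hk.eventually_gt_atTop 0, hv, hexp.eventually_lt_const one_half_pos,
        h0.eventually_lt_const (show (0 : ℝ) < 1 / 4 by norm_num)] with x hkx hvx hx hx4
      by_contra hcon
      rw [not_lt, le_div_iff₀ (by linarith)] at hcon
      have hmono := (bsNormalized_strictMonoOn (k x)).monotoneOn
        (show Real.sqrt (2 * a * k x) ∈ Ioi 0 from Real.sqrt_pos.2 (by positivity)) hvx
        ((Real.sqrt_le_left hvx.le).2 (by linarith))
      have := le_bsNormalized_sqrt ha1.le hkx
      linarith

/-! ### Slowly varying minorants -/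

/-- The lower bound for `g` is obtained at the points `2 ^ n * y` only, by iterating
`g (2 x) ≥ ρ * g x`; monotonicity of `c` extends it to the strikes in between. -/
theorem Antitone.decaysSubexponentially_of_isSlowlyVarying {c g : ℝ → ℝ} (hc : Antitone c)
    (hg : IsSlowlyVarying g) (hgc : ∀ᶠ x in atTop, 0 < g x ∧ g x ≤ c x) :
    DecaysSubexponentially atTop Real.log c := by
  intro ε hε
  set ρ : ℝ := Real.exp (-(ε / 2 * Real.log 2)) with hρ
  have hρ1 : ρ < 1 := Real.exp_lt_one_iff.2 (by have := Real.log_pos one_lt_two; nlinarith)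
  have hρ0 : 0 < ρ := Real.exp_pos _
  have hlim := hg.2 2 two_pos
  rw [Real.rpow_zero] at hlim
  obtain ⟨y, hy⟩ := eventually_atTop.1
    ((hlim.eventually_const_lt hρ1).and (hgc.and (eventually_gt_atTop 0)))
  have hy0 : 0 < y := (hy y le_rfl).2.2
  have hgy : 0 < g y := (hy y le_rfl).2.1.1
  have hpow : ∀ n : ℕ, y ≤ 2 ^ n * y := fun n =>
    le_mul_of_one_le_left hy0.le (one_le_pow₀ one_le_two)
  have hgpow : ∀ n : ℕ, ρ ^ n * g y ≤ g (2 ^ n * y) := by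
    intro n
    induction n with
    | zero => simp
    | succ n ih =>
      have h1 := hy _ (hpow n)
      have h2 := h1.1
      rw [lt_div_iff₀ h1.2.1.1] at h2
      calc ρ ^ (n + 1) * g y = ρ * (ρ ^ n * g y) := by ring
        _ ≤ ρ * g (2 ^ n * y) := by gcongr
        _ ≤ g (2 * (2 ^ n * y)) := h2.le
        _ = _ := by congr 1; ring
  filter_upwards [eventually_ge_atTop y, Real.tendsto_log_atTop.eventually_ge_atTop
    ((-(ε / 2 * Real.log y) - Real.log (ρ * g y)) / (ε / 2))] with K hK hKl
  have hK0 : 0 < K := hy0.trans_le hK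
  rw [div_le_iff₀ (by linarith)] at hKl
  obtain ⟨n, hn1, hn2⟩ := exists_nat_pow_near ((one_le_div hy0).2 hK) one_lt_two
  rw [div_lt_iff₀ hy0] at hn2
  have hn3 : n * Real.log 2 ≤ Real.log K - Real.log y := by
    rw [← Real.log_div hK0.ne' hy0.ne', ← Real.log_pow]
    exact Real.log_le_log (by positivity) hn1
  calc Real.exp (-(ε * Real.log K))
      ≤ Real.exp (Real.log (ρ * g y) + n * -(ε / 2 * Real.log 2)) :=
        Real.exp_le_exp.2 (by nlinarith)
    _ = ρ ^ (n + 1) * g y := by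
        rw [Real.exp_add, Real.exp_log (by positivity), Real.exp_nat_mul, ← hρ]; ring
    _ ≤ g (2 ^ (n + 1) * y) := hgpow _
    _ ≤ c (2 ^ (n + 1) * y) := (hy _ (hpow _)).2.1.2
    _ ≤ c K := hc hn2.le

/-- If `e` tends to `0` at infinity and is antitone, then `exp (-∫ t in 0..log x, e t)` is slowly
varying. -/
theorem isSlowlyVarying_exp_neg_integral_log {e : ℝ → ℝ} (he : Antitone e)
    (h0 : Tendsto e atTop (𝓝 0)) :
    IsSlowlyVarying fun x => Real.exp (-∫ t in (0 : ℝ)..Real.log x, e t) := by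
  have hint : ∀ a b : ℝ, IntervalIntegrable e volume a b := fun a b => he.intervalIntegrable
  refine ⟨⟨0, ?_⟩, fun lam hlam => ?_⟩
  · have hcont := intervalIntegral.continuous_primitive hint 0
    exact (Real.measurable_exp.comp
      ((hcont.measurable.comp Real.measurable_log).neg)).aemeasurable
  rw [Real.rpow_zero]
  have hlim : Tendsto (fun x => ∫ t in x..(Real.log lam + x), e t) atTop (𝓝 0) := by
    refine Metric.tendsto_nhds.2 fun δ hδ => ?_
    have hδ' : 0 < δ / (|Real.log lam| + 1) := by positivity
    obtain ⟨y, hy⟩ := eventually_atTop.1 (Metric.tendsto_nhds.1 h0 _ hδ')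
    filter_upwards [eventually_ge_atTop (y + |Real.log lam|)] with x hx
    have hb := intervalIntegral.norm_integral_le_of_norm_le_const (a := x)
      (b := Real.log lam + x) (f := e) (C := δ / (|Real.log lam| + 1)) fun t ht => by
        have h1 : min x (Real.log lam + x) < t := ht.1
        have h2 : y ≤ min x (Real.log lam + x) :=
          le_min (by linarith [abs_nonneg (Real.log lam)])
            (by linarith [neg_abs_le (Real.log lam)])
        have := hy t (h2.trans h1.le)
        rw [dist_zero_right] at this
        exact this.le
    rw [dist_zero_right]
    refine hb.trans_lt ?_
    rw [add_sub_cancel_right, div_mul_eq_mul_div, div_lt_iff₀ (by positivity)]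
    linarith
  have h1 := (Real.continuous_exp.tendsto _).comp ((hlim.comp Real.tendsto_log_atTop).neg)
  rw [neg_zero, Real.exp_zero] at h1
  refine h1.congr' ?_
  filter_upwards [eventually_gt_atTop 0] with x hx
  simp only [Function.comp]
  rw [← Real.exp_sub, Real.log_mul hlam.ne' hx.ne',
    ← intervalIntegral.integral_add_adjacent_intervals (hint 0 (Real.log x))
      (hint (Real.log x) (Real.log lam + Real.log x))]
  congr 1; ring

/-- The minorant is `exp (-∫ t in 0..log x, e t)`, where `e t` is the least rate `δ` such that
`exp (-δ log x) ≤ c x` for all `x` with `log x ≥ t`. As `e` is antitone, the integral is at least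
`e (log x) * log x`. -/
theorem DecaysSubexponentially.exists_isSlowlyVarying_le {c : ℝ → ℝ}
    (h : DecaysSubexponentially atTop Real.log c) :
    ∃ g : ℝ → ℝ, IsSlowlyVarying g ∧ ∀ᶠ x in atTop, 0 < g x ∧ g x ≤ c x := by
  have hexp : ∀ δ > 0, ∃ s : ℝ, ∀ y, s ≤ y → Real.exp (-(δ * y)) ≤ c (Real.exp y) := by
    intro δ hδ
    have := Real.tendsto_exp_atTop.eventually (h δ hδ)
    simp only [Real.log_exp] at this
    exact eventually_atTop.1 this
  obtain ⟨s, hs⟩ := hexp 1 one_pos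
  -- The maximum with `s` makes the set of admissible rates nonempty for every `t`.
  set S : ℝ → Set ℝ := fun t =>
    {δ | 0 ≤ δ ∧ ∀ y, max t s ≤ y → Real.exp (-(δ * y)) ≤ c (Real.exp y)} with hS
  have hSbdd : ∀ t, BddBelow (S t) := fun t => ⟨0, fun δ hδ => hδ.1⟩
  have hSne : ∀ t, (S t).Nonempty := fun t =>
    ⟨1, zero_le_one, fun y hy => hs y ((le_max_right _ _).trans hy)⟩
  have hSclosed : ∀ t, IsClosed (S t) := by
    intro t
    have : S t = Ici 0 ∩ ⋂ y, ⋂ (_ : max t s ≤ y), {δ | Real.exp (-(δ * y)) ≤ c (Real.exp y)} := by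
      ext δ; simp [hS]
    rw [this]
    refine isClosed_Ici.inter (isClosed_iInter fun y => isClosed_iInter fun _ => ?_)
    exact isClosed_le (by fun_prop) continuous_const
  have hmem : ∀ t, sInf (S t) ∈ S t := fun t => (hSclosed t).csInf_mem (hSne t) (hSbdd t)
  have hanti : Antitone fun t => sInf (S t) := fun a b hab =>
    csInf_le_csInf (hSbdd b) (hSne a) fun δ hδ =>
      ⟨hδ.1, fun y hy => hδ.2 y ((max_le_max_right s hab).trans hy)⟩
  have hlim : Tendsto (fun t => sInf (S t)) atTop (𝓝 0) := by
    refine tendsto_order.2 ⟨fun a ha => Eventually.of_forall fun t => ha.trans_le (hmem t).1,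
      fun a ha => ?_⟩
    obtain ⟨u, hu⟩ := hexp (a / 2) (half_pos ha)
    filter_upwards [eventually_ge_atTop u] with t ht
    have : a / 2 ∈ S t := ⟨(half_pos ha).le, fun y hy =>
      hu y (ht.trans ((le_max_left _ _).trans hy))⟩
    linarith [csInf_le (hSbdd t) this]
  refine ⟨_, isSlowlyVarying_exp_neg_integral_log hanti hlim, ?_⟩
  filter_upwards [eventually_gt_atTop 0, Real.tendsto_log_atTop.eventually_ge_atTop (max 0 s)]
    with x hx hlx
  refine ⟨Real.exp_pos _, ?_⟩
  have hl0 : 0 ≤ Real.log x := (le_max_left _ _).trans hlx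
  have h1 : sInf (S (Real.log x)) * Real.log x ≤ ∫ t in (0 : ℝ)..Real.log x, sInf (S t) := by
    have := intervalIntegral.integral_mono_on hl0 intervalIntegrable_const
      (hanti.intervalIntegrable (μ := volume)) (fun t ht => hanti ht.2)
    simpa [mul_comm] using this
  have h2 := (hmem (Real.log x)).2 (Real.log x)
    (max_le le_rfl ((le_max_right _ _).trans hlx))
  rw [Real.exp_log hx] at h2
  exact (Real.exp_le_exp.2 (neg_le_neg h1)).trans h2

theorem isSlowlyVarying_const {a : ℝ} (ha : a ≠ 0) : IsSlowlyVarying fun _ => a := by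
  refine ⟨⟨0, aemeasurable_const⟩, fun lam _ => ?_⟩
  simp only [Real.rpow_zero, div_self ha]
  exact tendsto_const_nhds

theorem exists_isSlowlyVarying_le_iff_decaysSubexponentially {c : ℝ → ℝ} (hc : Antitone c) :
    (∃ g : ℝ → ℝ, IsSlowlyVarying g ∧ ∃ K₀ : ℝ, ∀ K, K₀ < K → 0 < g K ∧ g K ≤ c K) ↔
      DecaysSubexponentially atTop Real.log c := by
  constructor
  · rintro ⟨g, hg, K₀, h⟩
    exact hc.decaysSubexponentially_of_isSlowlyVarying hg
      ((eventually_gt_atTop K₀).mono h)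
  · intro h
    obtain ⟨g, hg, hgc⟩ := h.exists_isSlowlyVarying_le
    obtain ⟨K₀, hK₀⟩ := eventually_atTop.1 hgc
    exact ⟨g, hg, K₀, fun K hK => hK₀ K hK.le⟩

theorem exists_isSlowlyVarying_le_iff_isWeakParetoType {c : ℝ → ℝ} (hc : Antitone c) {a b : ℝ}
    (hb : 0 ≤ b) (hpos : ∀ y, b < y → 0 < c y) (ha : 0 < a) (hle : ∀ y, b < y → c y ≤ a) :
    (∃ g : ℝ → ℝ, IsSlowlyVarying g ∧ ∃ K₀ : ℝ, ∀ K, K₀ < K → 0 < g K ∧ g K ≤ c K) ↔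
      IsWeakParetoType 0 c := by
  constructor
  · rintro ⟨g, hg, K₀, h⟩
    refine ⟨⟨b, hb, hc.measurable.aemeasurable, hpos⟩, g, fun _ => a, hg,
      isSlowlyVarying_const ha.ne', max K₀ b, fun y hy => ?_⟩
    have h1 := h y ((le_max_left _ _).trans_lt hy)
    exact ⟨h1.1, ha, h1.2, hle y ((le_max_right _ _).trans_lt hy)⟩
  · rintro ⟨-, f₁, f₂, hf₁, -, y₀, h⟩
    exact ⟨f₁, hf₁, y₀, fun K hK => ⟨(h K hK).1, (h K hK).2.2.1⟩⟩

/-! ### The call price as a function of the strike -/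

section CallPrice

variable {Ω : Type*} {m : MeasurableSpace Ω} {P : Measure Ω} {r x₀ : ℝ} {X : ℝ≥0 → Ω → ℝ}
  {T : ℝ≥0}

theorem IsStockPrice.exp_mul_integral_eq [IsProbabilityMeasure P] {ℱ : Filtration ℝ≥0 m}
    (hX : IsStockPrice P ℱ r x₀ X) (T : ℝ≥0) :
    Real.exp (-r * T) * ∫ ω, X T ω ∂P = x₀ := by
  have h := hX.martingale.setIntegral_eq (zero_le : 0 ≤ T) MeasurableSet.univ
  rw [setIntegral_univ, setIntegral_univ, integral_const_mul, integral_const_mul,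
    integral_congr_ae hX.initial] at h
  simpa using h.symm

theorem integrable_max_sub_const [IsFiniteMeasure P] (hi : Integrable (X T) P) (K : ℝ) :
    Integrable (fun ω => max (X T ω - K) 0) P :=
  (hi.sub (integrable_const K)).pos_part

theorem callPrice_antitone [IsFiniteMeasure P] (hi : Integrable (X T) P) :
    Antitone (callPrice P r X T) := fun a b hab => by
  unfold callPrice
  refine mul_le_mul_of_nonneg_left (integral_mono (integrable_max_sub_const hi b)
    (integrable_max_sub_const hi a) fun ω => ?_) (Real.exp_pos _).le
  exact max_le_max_right 0 (by linarith)

theorem tendsto_callPrice_atTop (hi : Integrable (X T) P) (h0 : ∀ ω, 0 ≤ X T ω) :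
    Tendsto (callPrice P r X T) atTop (𝓝 0) := by
  have h : Tendsto (fun K : ℝ => ∫ ω, max (X T ω - K) 0 ∂P) atTop (𝓝 (∫ _, (0 : ℝ) ∂P)) := by
    refine tendsto_integral_filter_of_dominated_convergence (X T) ?_ ?_ hi ?_
    · exact Eventually.of_forall fun K =>
        ((hi.aestronglyMeasurable.sub aestronglyMeasurable_const).sup aestronglyMeasurable_const)
    · filter_upwards [eventually_ge_atTop 0] with K hK
      refine ae_of_all _ fun ω => ?_
      rw [Real.norm_of_nonneg (le_max_right _ _)]
      exact max_le (by linarith) (h0 ω)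
    · refine ae_of_all _ fun ω => tendsto_const_nhds.congr' ?_
      filter_upwards [eventually_ge_atTop (X T ω)] with K hK
      exact (max_eq_right (by linarith)).symm
  have h2 := h.const_mul (Real.exp (-r * T))
  rw [integral_zero, mul_zero] at h2
  exact h2

/-- The price is strictly below `x₀`, since `X_T - (X_T - K)⁺ = min X_T K` vanishes only where
`X_T = 0`, and `X_T` has positive mean. -/
theorem IsStockPrice.callPrice_lt [IsProbabilityMeasure P] {ℱ : Filtration ℝ≥0 m}
    (hX : IsStockPrice P ℱ r x₀ X) (hT : 0 < T) {K : ℝ} (hK : 0 < K) :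
    callPrice P r X T K < x₀ := by
  have hi := hX.integrable T hT
  have hle : (fun ω => max (X T ω - K) 0) ≤ X T := fun ω =>
    max_le (by linarith) (hX.nonneg T ω)
  have hexp := Real.exp_pos (-r * T)
  have hmean := hX.exp_mul_integral_eq T
  have h1 : ∫ ω, max (X T ω - K) 0 ∂P ≤ ∫ ω, X T ω ∂P :=
    integral_mono (integrable_max_sub_const hi K) hi hle
  have h2 : ∫ ω, max (X T ω - K) 0 ∂P ≠ ∫ ω, X T ω ∂P := by
    intro h
    have hae := (integral_eq_iff_of_ae_le (integrable_max_sub_const hi K) hi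
      (ae_of_all _ hle)).1 h
    have hzero : X T =ᵐ[P] 0 := by
      filter_upwards [hae] with ω hω
      by_contra hne
      have hpos : 0 < X T ω := lt_of_le_of_ne (hX.nonneg T ω) (Ne.symm hne)
      exact (max_lt (by linarith) hpos).ne hω
    rw [integral_congr_ae hzero] at hmean
    simp only [Pi.zero_apply, integral_zero, mul_zero] at hmean
    exact hX.initial_pos.ne hmean
  calc _ < Real.exp (-r * T) * ∫ ω, X T ω ∂P :=
        mul_lt_mul_of_pos_left (lt_of_le_of_ne h1 h2) hexp
    _ = x₀ := hmean

end CallPrice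

/-! ### Implied volatility -/

theorem bsCallPrice_eq_bsNormalized {r x₀ : ℝ} {T : ℝ≥0} {K σ : ℝ} (hx : 0 < x₀) (hT : 0 < T)
    (hK : 0 < K) (hσ : 0 < σ) :
    bsCallPrice r x₀ T K σ =
      x₀ * bsNormalized (Real.log K - (Real.log x₀ + r * T)) (σ * Real.sqrt T) := by
  have hT' : (0 : ℝ) < T := hT
  have hs := Real.sqrt_pos.2 hT'
  have hsq := Real.sq_sqrt hT'.le
  have h1 : bsD1 r x₀ T K σ = -(Real.log K - (Real.log x₀ + r * T)) / (σ * Real.sqrt T) +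
      σ * Real.sqrt T / 2 := by
    unfold bsD1
    field_simp
    rw [hsq]
    ring
  have h2 : Real.exp (Real.log K - (Real.log x₀ + r * T)) = K / x₀ * Real.exp (-r * T) := by
    rw [show Real.log K - (Real.log x₀ + r * T) = Real.log K - Real.log x₀ + -r * T by ring,
      Real.exp_add, Real.exp_sub, Real.exp_log hK, Real.exp_log hx]
  rw [bsCallPrice, bsNormalized, bsD2, h1, h2, mul_sub]
  congr 1
  rw [show ∀ a b : ℝ, a + b / 2 - b = a - b / 2 by intro a b; ring]
  field_simp

theorem existsUnique_isImpliedVol {r x₀ : ℝ} {C : ℝ≥0 → ℝ → ℝ} {T : ℝ≥0} {K : ℝ} (hx : 0 < x₀)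
    (hT : 0 < T) (hK : x₀ * Real.exp (r * T) ≤ K) (h0 : 0 < C T K) (h1 : C T K < x₀) :
    ∃! σ : ℝ, IsImpliedVol r x₀ C T K σ := by
  have hs : 0 < Real.sqrt T := Real.sqrt_pos.2 hT
  have hK0 : 0 < K := lt_of_lt_of_le (by positivity) hK
  have hk : 0 ≤ Real.log K - (Real.log x₀ + r * T) := by
    have := Real.log_le_log (by positivity) hK
    rw [Real.log_mul hx.ne' (Real.exp_pos _).ne', Real.log_exp] at this
    linarith
  obtain ⟨v, ⟨hv, hve⟩, huniq⟩ := existsUnique_bsNormalized_eq hk (div_pos h0 hx)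
    ((div_lt_one hx).2 h1)
  refine ⟨v / Real.sqrt T, ⟨div_pos hv hs, ?_⟩, fun σ hσ => ?_⟩
  · rw [bsCallPrice_eq_bsNormalized hx hT hK0 (div_pos hv hs), div_mul_cancel₀ _ hs.ne', ← hve]
    field_simp
  · rw [eq_div_iff hs.ne']
    refine huniq _ ⟨mul_pos hσ.1 hs, ?_⟩
    rw [hσ.2, bsCallPrice_eq_bsNormalized hx hT hK0 hσ.1]
    field_simp

theorem isImpliedVol_impliedVol {r x₀ : ℝ} {C : ℝ≥0 → ℝ → ℝ} {T : ℝ≥0} {K : ℝ}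
    (h : ∃! σ : ℝ, IsImpliedVol r x₀ C T K σ) :
    IsImpliedVol r x₀ C T K (impliedVol r x₀ C T K) := by
  rw [impliedVol, dif_pos h]
  exact h.choose_spec.1

theorem isEquivalent_sqrt_log_iff {f : ℝ → ℝ} {T : ℝ} (hT : 0 < T) (hf : ∀ᶠ K in atTop, 0 < f K)
    (κ : ℝ) :
    f ~[atTop] (fun K => (2 / T) ^ (1 / 2 : ℝ) * Real.sqrt (Real.log K)) ↔
      Tendsto (fun K => (f K * Real.sqrt T) ^ 2 / (2 * (Real.log K - κ))) atTop (𝓝 1) := by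
  have hlog := Real.tendsto_log_atTop.eventually_gt_atTop (max 0 κ)
  have hratio : Tendsto (fun K => (Real.log K - κ) / Real.log K) atTop (𝓝 1) := by
    have h : Tendsto (fun K : ℝ => 1 - κ / Real.log K) atTop (𝓝 (1 - 0)) :=
      tendsto_const_nhds.sub (tendsto_const_nhds.div_atTop Real.tendsto_log_atTop)
    rw [sub_zero] at h
    refine h.congr' ?_
    filter_upwards [hlog] with K hK
    have : Real.log K ≠ 0 := ((le_max_left _ _).trans_lt hK).ne'
    field_simp
  have hsq : ∀ᶠ K in atTop, ((f K / ((2 / T) ^ (1 / 2 : ℝ) * Real.sqrt (Real.log K))) ^ 2) =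
      (f K * Real.sqrt T) ^ 2 / (2 * (Real.log K - κ)) * ((Real.log K - κ) / Real.log K) := by
    filter_upwards [hlog] with K hK
    have h1 : 0 < Real.log K := (le_max_left _ _).trans_lt hK
    have h2 : 0 < Real.log K - κ := sub_pos.2 ((le_max_right _ _).trans_lt hK)
    rw [← Real.sqrt_eq_rpow, div_pow, mul_pow, mul_pow, Real.sq_sqrt h1.le,
      Real.sq_sqrt (by positivity), Real.sq_sqrt hT.le]
    field_simp
  rw [isEquivalent_iff_tendsto_one (by
    filter_upwards [hlog] with K hK
    have h1 : 0 < Real.log K := (le_max_left _ _).trans_lt hK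
    positivity)]
  constructor
  · intro h
    have h1 := (h.pow 2).div hratio one_ne_zero
    rw [one_pow, div_one] at h1
    refine h1.congr' ?_
    filter_upwards [hsq, hlog] with K hK hl
    have h1 : 0 < Real.log K := (le_max_left _ _).trans_lt hl
    have h2 : 0 < Real.log K - κ := sub_pos.2 ((le_max_right _ _).trans_lt hl)
    rw [Pi.div_apply, Pi.div_apply, hK, mul_div_cancel_right₀ _ (div_pos h2 h1).ne']
  · intro h
    have h1 := (h.mul hratio).sqrt
    rw [one_mul, Real.sqrt_one] at h1
    refine h1.congr' ?_
    filter_upwards [hsq, hf] with K hK hfK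
    rw [← hK, Real.sqrt_sq (by positivity), Pi.div_apply]

theorem theorem6 {Ω : Type*} {m : MeasurableSpace Ω} (P : Measure Ω) [IsProbabilityMeasure P]
    (ℱ : Filtration ℝ≥0 m) (r x₀ : ℝ) (X : ℝ≥0 → Ω → ℝ)
    (hX : IsStockPrice P ℱ r x₀ X)
    (hC : IsPFInfty r x₀ (callPrice P r X))
    (T : ℝ≥0) (hT : 0 < T)
    (hp : momentExponent P (X T) = 0) :
    (∀ K : ℝ, x₀ * Real.exp (r * T) ≤ K →
      ∃! σ : ℝ, IsImpliedVol r x₀ (callPrice P r X) T K σ) ∧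
    ((fun K => impliedVol r x₀ (callPrice P r X) T K) ~[atTop]
        (fun K => (2 / (T : ℝ)) ^ (1 / 2 : ℝ) * Real.sqrt (Real.log K)) ↔
      ∃ g₁ : ℝ → ℝ, IsSlowlyVarying g₁ ∧
        ∃ K₀ : ℝ, ∀ K, K₀ < K → 0 < g₁ K ∧ g₁ K ≤ callPrice P r X T K) ∧
    ((fun K => impliedVol r x₀ (callPrice P r X) T K) ~[atTop]
        (fun K => (2 / (T : ℝ)) ^ (1 / 2 : ℝ) * Real.sqrt (Real.log K)) ↔
      IsWeakParetoType 0 (callPrice P r X T)) := by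
  have hx := hX.initial_pos
  have hi := hX.integrable T hT
  have hb : 0 < x₀ * Real.exp (r * T) := by positivity
  have hpos : ∀ K, x₀ * Real.exp (r * T) ≤ K → 0 < callPrice P r X T K := fun K hK =>
    hC T K hT (hb.trans_le hK) hK
  have hlt : ∀ K, x₀ * Real.exp (r * T) ≤ K → callPrice P r X T K < x₀ := fun K hK =>
    hX.callPrice_lt hT (hb.trans_le hK)
  have hex : ∀ K, x₀ * Real.exp (r * T) ≤ K →
      ∃! σ : ℝ, IsImpliedVol r x₀ (callPrice P r X) T K σ := fun K hK =>
    existsUnique_isImpliedVol hx hT hK (hpos K hK) (hlt K hK)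
  have hanti : Antitone (callPrice P r X T) := callPrice_antitone hi
  set I : ℝ → ℝ := fun K => impliedVol r x₀ (callPrice P r X) T K with hI
  set κ : ℝ := Real.log x₀ + r * T
  have hs : 0 < Real.sqrt T := Real.sqrt_pos.2 hT
  have hspec : ∀ᶠ K in atTop, 0 < I K ∧
      bsNormalized (Real.log K - κ) (I K * Real.sqrt T) = x₀⁻¹ * callPrice P r X T K := by
    filter_upwards [eventually_ge_atTop (x₀ * Real.exp (r * T))] with K hK
    have h := isImpliedVol_impliedVol (hex K hK)
    refine ⟨h.1, ?_⟩
    rw [h.2, bsCallPrice_eq_bsNormalized hx hT (hb.trans_le hK) h.1, inv_mul_cancel_left₀ hx.ne']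
  have hk : Tendsto (fun K => Real.log K - κ) atTop atTop :=
    tendsto_atTop_add_const_right _ _ Real.tendsto_log_atTop
  have hzero : Tendsto (fun K => bsNormalized (Real.log K - κ) (I K * Real.sqrt T)) atTop
      (𝓝 0) := by
    have h := (tendsto_callPrice_atTop (r := r) hi (hX.nonneg T)).const_mul x₀⁻¹
    rw [mul_zero] at h
    exact h.congr' (hspec.mono fun K hK => hK.2.symm)
  have hdecay : DecaysSubexponentially atTop (fun K => Real.log K - κ)
      (fun K => bsNormalized (Real.log K - κ) (I K * Real.sqrt T)) ↔
      DecaysSubexponentially atTop Real.log (callPrice P r X T) := by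
    constructor
    · intro h ε hε
      filter_upwards [h.const_mul_shift hk hx κ ε hε, hspec] with K h1 h2
      rwa [h2.2, mul_inv_cancel_left₀ hx.ne', sub_add_cancel] at h1
    · intro h ε hε
      filter_upwards [h.const_mul_shift Real.tendsto_log_atTop (inv_pos.2 hx) (-κ) ε hε, hspec]
        with K h1 h2
      rwa [h2.2]
  have hmain := (isEquivalent_sqrt_log_iff (f := I) (T := T) hT (hspec.mono fun K hK => hK.1)
    κ).trans ((tendsto_sq_div_iff_decaysSubexponentially hk
      (hspec.mono fun K hK => mul_pos hK.1 hs) hzero).trans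
      (hdecay.trans (exists_isSlowlyVarying_le_iff_decaysSubexponentially hanti).symm))
  exact ⟨hex, hmain, hmain.trans (exists_isSlowlyVarying_le_iff_isWeakParetoType hanti hb.le
    (fun y hy => hpos y hy.le) hx fun y hy => (hlt y hy.le).le)⟩
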